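/- For $0<\alpha\le 2$, $\alpha\ne 1$, $b>0$ and real $\eta$ (with $|\eta|\le\alpha$ if $\alpha<1$ and $|\eta|\le 2-\alpha$ if $\alpha>1$) let $$p_\alpha(x;\eta,b)=\frac1{2\pi}\int_{-\infty}^{\infty}e^{-i\lambda x}\exp\Big\{-b|\lambda|^{\alpha}e^{-\frac{i\pi\eta}{2}\frac{\lambda}{|\lambda|}}\Big\}\,d\lambda .$$ Let $1/2\le\gamma<1$, $\alpha=1/\gamma$ and $b>0$. Let $D$ be a $\gamma$-stable subordinator, that is, a real Lévy process with almost surely nondecreasing paths, such that $D(t)$ has the density $p_\gamma(\cdot\,;\gamma,bt)$ for every $t>0$, and let $$E_t=\inf\{x>0: D(x)>t\}$$ be its hitting time (inverse) process. Let $Y$ be the totally negatively skewed $\alpha$-stable Lévy motion, that is, a real Lévy process such that $Y(t)$ has the density $P(\cdot,t)=p_\alpha(\cdot\,;2-\alpha,b^{-\alpha}t)$ for every $t>0$. Then: (i) $P(Y(t)>0)=1/\alpha$ for all $t>0$. (ii) For each $t>0$, $E_t$ is almost surely finite and has the same distribution as $Y(t)$ conditioned on $Y(t)>0$. Moreover,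 with $g_\gamma(x)=p_\gamma(x;\gamma,b)$ the density of $D(1)$, for each $t>0$ the random variable $E_t$ has the density $$h(x,t)=\frac t\gamma\,x^{-1-1/\gamma}\,g_\gamma\big(t\,x^{-1/\gamma}\big)\quad(x>0),\qquad h(x,t)=0\quad(x\le 0),$$ and $P(x,t)=\gamma\,h(x,t)$ for all $t>0$ and $x>0$. -/

import Mathlib

open MeasureTheory ProbabilityTheory Filter Topology
open scoped NNReal ENNReal

noncomputable section

/-- The function `λ ↦ exp (-b |λ|^α exp (-(iπη/2) λ/|λ|))`, the characteristic function of the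
stable law with index `α ≠ 1` and parameters `η` and `b`. At `λ = 0` the value is `1`
(for `α > 0`), whatever the convention for `λ/|λ|`. -/
def stableCharFun (α η b l : ℝ) : ℂ :=
  Complex.exp (-((b * |l| ^ α : ℝ) : ℂ) *
    Complex.exp (-(Complex.I * ((Real.pi * η / 2 : ℝ) : ℂ) * ((l / |l| : ℝ) : ℂ))))

/-- The stable density `p_α(x; η, b) = (1/2π) ∫ e^{-iλx} exp (-b |λ|^α e^{-(iπη/2) λ/|λ|}) dλ`.
The complex integral is always real (see `ofReal_stableDensity`), so that taking the real part only
changes the type. -/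
def stableDensity (α η b x : ℝ) : ℝ :=
  (((1 / (2 * Real.pi) : ℝ) : ℂ) *
    ∫ l : ℝ, Complex.exp (-(Complex.I * (l : ℂ) * (x : ℂ))) * stableCharFun α η b l).re

theorem ofReal_stableDensity (α η b x : ℝ) :
    (stableDensity α η b x : ℂ) = ((1 / (2 * Real.pi) : ℝ) : ℂ) *
      ∫ l : ℝ, Complex.exp (-(Complex.I * (l : ℂ) * (x : ℂ))) * stableCharFun α η b l := by
  unfold stableDensity
  rw [← Complex.conj_eq_iff_re, map_mul, Complex.conj_ofReal, ← integral_conj]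
  congr 1
  rw [← integral_neg_eq_self]
  refine integral_congr_ae (Eventually.of_forall fun l => ?_)
  simp only [stableCharFun, map_mul, ← Complex.exp_conj, map_neg, Complex.conj_ofReal,
    Complex.conj_I, abs_neg, Complex.ofReal_neg, neg_div]
  congr 2 <;> ring_nf

variable {Ω : Type*} [MeasurableSpace Ω]

/-- The real random variable `X` has the density `f` under `P`. -/
structure HasDensity (X : Ω → ℝ) (f : ℝ → ℝ) (P : Measure Ω) : Prop where
  aemeasurable : AEMeasurable X P
  nonneg : ∀ᵐ x, 0 ≤ f x
  map_eq : P.map X = volume.withDensity (fun x => ENNReal.ofReal (f x))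

/-- A real-valued Lévy process: it starts at `0`, has independent and stationary increments and
is continuous in probability. No regularity of the paths is asked for. -/
structure IsLevyProcess (X : ℝ≥0 → Ω → ℝ) (P : Measure Ω) : Prop where
  measurable : ∀ t, Measurable (X t)
  zero : ∀ᵐ ω ∂P, X 0 ω = 0
  indep_increments : HasIndepIncrements X P
  stationary_increments : ∀ s t, IdentDistrib (X (s + t) - X s) (X t) P P
  stochastically_continuous : ∀ s, TendstoInMeasure P X (𝓝 s) (X s)

/-- A subordinator: a Lévy process with almost surely nondecreasing paths. -/
structure IsSubordinator (X : ℝ≥0 → Ω → ℝ) (P : Measure Ω) : Prop extends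
    IsLevyProcess X P where
  monotone : ∀ᵐ ω ∂P, Monotone fun t => X t ω

/-- The hitting time (inverse) process `E_t = inf {x > 0 : D(x) > t}`, with `inf ∅ = ∞`. -/
def hittingTimeProcess (D : ℝ≥0 → Ω → ℝ) (t : ℝ≥0) (ω : Ω) : ℝ≥0∞ :=
  ⨅ (x : ℝ≥0) (_ : 0 < x ∧ (t : ℝ) < D x ω), (x : ℝ≥0∞)

/-- The function `h(x, t) = (t/γ) x^{-1-1/γ} g(t x^{-1/γ})` on `x > 0`, where
`g = p_γ(·; γ, b)`, extended by `0` to `x ≤ 0`. -/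
def inverseStableDensity (γ b t : ℝ) : ℝ → ℝ :=
  (Set.Ioi (0 : ℝ)).indicator fun x =>
    t / γ * x ^ (-1 - 1 / γ) * stableDensity γ γ b (t * x ^ (-1 / γ))

end

/-!
Two independent facts are combined.

*Inversion.* On nondecreasing paths, `E_t < x` implies `D x > t`, which implies `E_t ≤ x`. By
self-similarity (`stableDensity_mul`) `D x` is distributed as `x ^ (1/γ) D 1`, and the change of
variables `u = c r ^ (-1/γ)` (`lintegral_inverseStableDensity`) identifies `P (D x > t)` with
`∫_{(0, x)} h(r, t) dr`. Since this is continuous in `x`, the law of `E_t` has density `h(·, t)`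
(`map_hittingTimeProcess`). The total mass of `h` is `P (D 1 > 0)`, which is `1`.

*Duality.* The identity `p_α(x; 2 - α, b ^ (-α) t) = γ h(x, t)` of Zolotarev is proved by contour
integration. By conjugation symmetry both densities are real parts of integrals over the half-line
`λ > 0`. Substituting `z = iλx` on the left, and integrating by parts before substituting `z` for
(the conjugate of) `b (-iλ) ^ γ` on the right, one obtains integrals of the same function
`exp (-z + k z ^ α)`, along the ray `arg z = π/2` (`stableDensity_two_sub_eq`) and along the ray
`arg z = πγ/2 = π/(2α)` (`stableDensity_self_eq`), respectively. In the sector between the two rays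
neither `Re (-z)` nor `Re (z ^ α)` is positive, and they do not vanish together, so the integrand
decays exponentially and the contour can be rotated (`integral_rayIntegrand_eq`). Working with
`w = log z` makes the integrand entire and turns the sector into a strip, where Cauchy's theorem for
rectangles suffices.

The duality shows that on `(0, ∞)` the law of `Y t` is `γ` times the law of `E_t`
(`measure_Ioi_inter_preimage`); as the latter is a probability measure, `P (Y t > 0) = γ = 1/α`, and
conditioning on `Y t > 0` yields the law of `E_t`.
-/

/-! ### Integrals over the half-line in exponential coordinates -/

theorem image_exp_affine_univ {p : ℝ} (hp : 0 < p) (q : ℝ) :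
    (fun u : ℝ => Real.exp (p * u + q)) '' Set.univ = Set.Ioi 0 := by
  ext x
  simp only [Set.image_univ, Set.mem_range, Set.mem_Ioi]
  constructor
  · rintro ⟨u, rfl⟩
    exact Real.exp_pos _
  · intro hx
    refine ⟨(Real.log x - q) / p, ?_⟩
    rw [mul_div_cancel₀ _ hp.ne', sub_add_cancel, Real.exp_log hx]

theorem hasDerivAt_exp_affine (p q u : ℝ) :
    HasDerivAt (fun u : ℝ => Real.exp (p * u + q)) (p * Real.exp (p * u + q)) u := by
  have h := (((hasDerivAt_id u).const_mul p).add_const q).exp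
  simpa [mul_comm] using h

theorem injective_exp_affine {p : ℝ} (hp : 0 < p) (q : ℝ) :
    Function.Injective (fun u : ℝ => Real.exp (p * u + q)) := by
  intro u v h
  have := Real.exp_injective h
  exact mul_left_cancel₀ hp.ne' (add_right_cancel this)

theorem setIntegral_Ioi_eq_integral_exp {E : Type*} [NormedAddCommGroup E] [NormedSpace ℝ E]
    {p : ℝ} (hp : 0 < p) (q : ℝ) (f : ℝ → E) :
    ∫ r in Set.Ioi (0 : ℝ), f r =
      ∫ u : ℝ, (p * Real.exp (p * u + q)) • f (Real.exp (p * u + q)) := by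
  rw [← image_exp_affine_univ hp q, integral_image_eq_integral_abs_deriv_smul MeasurableSet.univ
    (fun u _ => (hasDerivAt_exp_affine p q u).hasDerivWithinAt)
    (injective_exp_affine hp q).injOn f, setIntegral_univ]
  simp_rw [abs_of_pos (mul_pos hp (Real.exp_pos _))]

theorem integrable_exp_mul_exp_neg_exp {c δ : ℝ} (hc : 0 < c) (hδ : 0 < δ) :
    Integrable fun u : ℝ => Real.exp (c * u) * Real.exp (-(δ * Real.exp u)) := by
  have h := integrableOn_rpow_mul_exp_neg_mul_rpow (s := c - 1) (by linarith) one_pos hδ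
  rw [← image_exp_affine_univ one_pos 0, integrableOn_image_iff_integrableOn_abs_deriv_smul
    MeasurableSet.univ (fun u _ => (hasDerivAt_exp_affine 1 0 u).hasDerivWithinAt)
    (injective_exp_affine one_pos 0).injOn, integrableOn_univ] at h
  refine h.congr (Eventually.of_forall fun u => ?_)
  simp only [one_mul, add_zero, abs_of_pos (Real.exp_pos u), Real.rpow_one, smul_eq_mul, neg_mul]
  rw [← mul_assoc, ← Real.exp_mul, ← Real.exp_add]
  congr 2
  ring

theorem tendsto_exp_mul_exp_neg_exp_atTop {δ : ℝ} (hδ : 0 < δ) :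
    Tendsto (fun u : ℝ => Real.exp u * Real.exp (-(δ * Real.exp u))) atTop (𝓝 0) := by
  have h := (Real.tendsto_pow_mul_exp_neg_atTop_nhds_zero 1).comp
    (Real.tendsto_exp_atTop.const_mul_atTop hδ)
  have h2 := h.const_mul δ⁻¹
  rw [mul_zero] at h2
  refine h2.congr fun u => ?_
  simp only [Function.comp, pow_one]
  field_simp

theorem tendsto_exp_mul_exp_neg_exp_atBot (δ : ℝ) :
    Tendsto (fun u : ℝ => Real.exp u * Real.exp (-(δ * Real.exp u))) atBot (𝓝 0) := by
  have h2 : Tendsto (fun u : ℝ => Real.exp (-(δ * Real.exp u))) atBot (𝓝 (Real.exp (-(δ * 0)))) :=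
    (Real.continuous_exp.tendsto _).comp ((Real.tendsto_exp_atBot.const_mul δ).neg)
  simpa using Real.tendsto_exp_atBot.mul h2

/-! ### Rotating the ray of integration -/

/-- The integral of `exp (-z + k z ^ α)` along a ray from `0`, in the logarithmic coordinate
`z = exp w`: the integrand is entire in `w`, and the ray at angle `θ` is the line `Im w = θ`. -/
noncomputable def rayIntegrand (α k : ℝ) (w : ℂ) : ℂ :=
  Complex.exp (w - Complex.exp w + k * Complex.exp (α * w))

theorem differentiable_rayIntegrand (α k : ℝ) : Differentiable ℂ (rayIntegrand α k) := by
  unfold rayIntegrand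
  fun_prop

theorem norm_rayIntegrand (α k u θ : ℝ) :
    ‖rayIntegrand α k (u + θ * Complex.I)‖ =
      Real.exp (u - Real.exp u * Real.cos θ + k * Real.exp (α * u) * Real.cos (α * θ)) := by
  have h : (α : ℂ) * (u + θ * Complex.I) = ((α * u : ℝ) : ℂ) + ((α * θ : ℝ) : ℂ) * Complex.I := by
    push_cast; ring
  rw [rayIntegrand, Complex.norm_exp, h]
  congr 1
  simp only [Complex.add_re, Complex.sub_re, Complex.ofReal_re, Complex.exp_re, Complex.add_im,
    Complex.mul_re, Complex.mul_im, Complex.I_re, Complex.I_im, Complex.ofReal_im]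
  simp
  ring

/-- In the sector `π/(2α) ≤ θ ≤ π/2` both exponents `-z` and `z ^ α` have nonpositive real part,
and never both zero, which gives exponential decay uniformly in the angle. -/
theorem exists_norm_rayIntegrand_le {α k : ℝ} (hα : 1 < α) (hα2 : α ≤ 2) (hk : 0 < k) :
    ∃ C δ : ℝ, 0 < δ ∧ ∀ u θ : ℝ, θ ∈ Set.Icc (Real.pi / (2 * α)) (Real.pi / 2) →
      ‖rayIntegrand α k (u + θ * Complex.I)‖ ≤
        C * (Real.exp u * Real.exp (-(δ * Real.exp u))) := by
  have hπ := Real.pi_pos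
  have hα0 : 0 < α := by linarith
  have hlow : Real.pi / (2 * α) < Real.pi / 2 := by
    apply div_lt_div_of_pos_left hπ two_pos; linarith
  have hlow0 : 0 < Real.pi / (2 * α) := by positivity
  have hcos : ∀ θ ∈ Set.Icc (Real.pi / (2 * α)) (Real.pi / 2), 0 ≤ Real.cos θ := fun θ hθ =>
    Real.cos_nonneg_of_mem_Icc ⟨by linarith [hθ.1], hθ.2⟩
  have hle : ∀ θ ∈ Set.Icc (Real.pi / (2 * α)) (Real.pi / 2), Real.pi / 2 ≤ α * θ := by
    intro θ hθ
    have := mul_le_mul_of_nonneg_left hθ.1 hα0.le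
    calc Real.pi / 2 = α * (Real.pi / (2 * α)) := by field_simp
      _ ≤ α * θ := this
  have hub : ∀ θ ∈ Set.Icc (Real.pi / (2 * α)) (Real.pi / 2), α * θ ≤ Real.pi := by
    intro θ hθ
    have h1 := mul_le_mul_of_nonneg_left hθ.2 hα0.le
    nlinarith
  have hcos' : ∀ θ ∈ Set.Icc (Real.pi / (2 * α)) (Real.pi / 2), Real.cos (α * θ) ≤ 0 := fun θ hθ =>
    Real.cos_nonpos_of_pi_div_two_le_of_le (hle θ hθ) (by linarith [hub θ hθ])
  have hpos : ∀ θ ∈ Set.Icc (Real.pi / (2 * α)) (Real.pi / 2),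
      0 < Real.cos θ - k * Real.cos (α * θ) := by
    intro θ hθ
    rcases hθ.2.lt_or_eq with h | h
    · have : 0 < Real.cos θ := Real.cos_pos_of_mem_Ioo ⟨by linarith [hθ.1], h⟩
      nlinarith [hcos' θ hθ]
    · have : Real.cos (α * θ) < 0 := by
        refine Real.cos_neg_of_pi_div_two_lt_of_lt ?_ (by linarith [hub θ hθ])
        rw [h]; nlinarith
      nlinarith [hcos θ hθ]
  obtain ⟨θ₀, hθ₀, hmin⟩ := isCompact_Icc.exists_isMinOn (Set.nonempty_Icc.2 hlow.le)
    (f := fun θ => Real.cos θ - k * Real.cos (α * θ)) (by fun_prop)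
  set δ := Real.cos θ₀ - k * Real.cos (α * θ₀) with hδ
  have hδ0 : 0 < δ := hpos θ₀ hθ₀
  -- The factor `exp δ` makes the bound trivially true for `|z| ≤ 1`, that is `u ≤ 0`; for `|z| ≥ 1`
  -- one has `|z| ≤ |z| ^ α`, so the exponent is at most `-δ |z|`.
  refine ⟨Real.exp δ, δ, hδ0, fun u θ hθ => ?_⟩
  rw [norm_rayIntegrand, ← Real.exp_add, ← Real.exp_add]
  apply Real.exp_le_exp.2
  have hm : δ ≤ Real.cos θ - k * Real.cos (α * θ) := hmin hθ
  have h1 := mul_nonneg (Real.exp_pos u).le (hcos θ hθ)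
  have h2 : k * Real.cos (α * θ) ≤ 0 := mul_nonpos_of_nonneg_of_nonpos hk.le (hcos' θ hθ)
  rcases le_total u 0 with hu | hu
  · have h3 : Real.exp u ≤ 1 := Real.exp_le_one_iff.2 hu
    have h4 := mul_nonpos_of_nonneg_of_nonpos (Real.exp_pos (α * u)).le h2
    nlinarith
  · have h3 : Real.exp u ≤ Real.exp (α * u) := Real.exp_le_exp.2 (by nlinarith)
    have h4 := mul_le_mul_of_nonpos_right h3 h2
    have h5 := mul_le_mul_of_nonneg_left hm (Real.exp_pos u).le
    nlinarith

theorem integrable_rayIntegrand {α k θ : ℝ} (hα : 1 < α) (hα2 : α ≤ 2) (hk : 0 < k)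
    (hθ : θ ∈ Set.Icc (Real.pi / (2 * α)) (Real.pi / 2)) :
    Integrable fun u : ℝ => rayIntegrand α k (u + θ * Complex.I) := by
  obtain ⟨C, δ, hδ, hC⟩ := exists_norm_rayIntegrand_le hα hα2 hk
  have h := (integrable_exp_mul_exp_neg_exp one_pos hδ).const_mul C
  refine h.mono' ?_ (Eventually.of_forall fun u => by simpa using hC u θ hθ)
  exact ((differentiable_rayIntegrand α k).continuous.comp (by fun_prop)).aestronglyMeasurable

/-- Cauchy's theorem in the sector `π/(2α) ≤ arg z ≤ π/2`: the integrals of `exp (-z + k z ^ α)`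
along the two boundary rays agree. -/
theorem integral_rayIntegrand_eq {α k : ℝ} (hα : 1 < α) (hα2 : α ≤ 2) (hk : 0 < k) :
    ∫ u : ℝ, rayIntegrand α k (u + (Real.pi / (2 * α) : ℝ) * Complex.I) =
      ∫ u : ℝ, rayIntegrand α k (u + (Real.pi / 2 : ℝ) * Complex.I) := by
  obtain ⟨C, δ, hδ, hC⟩ := exists_norm_rayIntegrand_le hα hα2 hk
  have hlow : Real.pi / (2 * α) ≤ Real.pi / 2 := by
    apply div_le_div_of_nonneg_left Real.pi_pos.le two_pos; linarith
  set a := Real.pi / (2 * α) with ha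
  set c := Real.pi / 2 with hc
  -- The vertical sides of the rectangle correspond to the arcs of radius `exp u`.
  let V : ℝ → ℂ := fun u => ∫ θ in a..c, rayIntegrand α k (u + θ * Complex.I)
  have hVbound : ∀ u, ‖V u‖ ≤ C * (Real.exp u * Real.exp (-(δ * Real.exp u))) * |c - a| := by
    intro u
    refine intervalIntegral.norm_integral_le_of_norm_le_const fun θ hθ => hC u θ ?_
    rw [Set.uIoc_of_le hlow] at hθ
    exact ⟨hθ.1.le, hθ.2⟩
  have hVtop : Tendsto V atTop (𝓝 0) := by
    refine squeeze_zero_norm hVbound ?_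
    simpa using ((tendsto_exp_mul_exp_neg_exp_atTop hδ).const_mul C).mul_const |c - a|
  have hVbot : Tendsto V atBot (𝓝 0) := by
    refine squeeze_zero_norm hVbound ?_
    simpa using ((tendsto_exp_mul_exp_neg_exp_atBot δ).const_mul C).mul_const |c - a|
  have hrect : ∀ R : ℝ,
      (∫ u in (-R)..R, rayIntegrand α k (u + a * Complex.I)) -
        (∫ u in (-R)..R, rayIntegrand α k (u + c * Complex.I)) +
        Complex.I * V R - Complex.I * V (-R) = 0 := by
    intro R
    have h := Complex.integral_boundary_rect_eq_zero_of_differentiableOn (rayIntegrand α k)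
      (⟨-R, a⟩ : ℂ) (⟨R, c⟩ : ℂ) (differentiable_rayIntegrand α k).differentiableOn
    simpa only [smul_eq_mul] using h
  have hlim := ((intervalIntegral_tendsto_integral
    (integrable_rayIntegrand (θ := a) hα hα2 hk ⟨le_rfl, hlow⟩) tendsto_neg_atTop_atBot
      tendsto_id).sub (intervalIntegral_tendsto_integral
    (integrable_rayIntegrand (θ := c) hα hα2 hk ⟨hlow, le_rfl⟩) tendsto_neg_atTop_atBot
      tendsto_id)).add (hVtop.const_mul Complex.I)
  have hlim2 := hlim.sub ((hVbot.comp tendsto_neg_atTop_atBot).const_mul Complex.I)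
  have h0 := tendsto_nhds_unique (hlim2.congr hrect) tendsto_const_nhds
  simpa [sub_eq_zero] using h0

/-! ### Stable densities as integrals over the half-line -/

theorem norm_stableCharFun {α : ℝ} (hα : 0 < α) (η b l : ℝ) :
    ‖stableCharFun α η b l‖ = Real.exp (-(b * Real.cos (Real.pi * η / 2)) * |l| ^ α) := by
  have h : -(Complex.I * ((Real.pi * η / 2 : ℝ) : ℂ) * ((l / |l| : ℝ) : ℂ)) =
      ((-(Real.pi * η / 2 * (l / |l|)) : ℝ) : ℂ) * Complex.I := by push_cast; ring
  rw [stableCharFun, Complex.norm_exp, ← Complex.ofReal_neg, Complex.re_ofReal_mul, h,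
    Complex.exp_ofReal_mul_I_re, Real.cos_neg]
  rcases lt_trichotomy l 0 with hl | rfl | hl
  · rw [abs_of_neg hl, div_neg, div_self hl.ne, mul_neg_one, Real.cos_neg]
    ring_nf
  · simp [Real.zero_rpow hα.ne']
  · rw [abs_of_pos hl, div_self hl.ne', mul_one]
    ring_nf

theorem integrable_exp_neg_mul_abs_rpow {α c : ℝ} (hα : 0 < α) (hc : 0 < c) :
    Integrable fun l : ℝ => Real.exp (-c * |l| ^ α) := by
  have h : IntegrableOn (fun l : ℝ => Real.exp (-c * |l| ^ α)) (Set.Ioi 0) := by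
    refine (integrableOn_rpow_mul_exp_neg_mul_rpow (s := 0) (by norm_num) hα hc).congr_fun
      (fun l hl => ?_) measurableSet_Ioi
    simp [abs_of_pos (Set.mem_Ioi.1 hl)]
  rw [← integrableOn_univ, ← Set.Iic_union_Ioi (a := (0 : ℝ)), integrableOn_union]
  refine ⟨?_, h⟩
  rw [integrableOn_Iic_iff_integrableOn_Iio]
  have h' := h
  rw [← neg_zero] at h'
  simpa using h'.comp_neg_Iio

theorem measurable_stableCharFun (α η b : ℝ) : Measurable (stableCharFun α η b) := by
  unfold stableCharFun
  fun_prop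

theorem norm_exp_neg_I_mul (l x : ℝ) : ‖Complex.exp (-(Complex.I * (l : ℂ) * (x : ℂ)))‖ = 1 := by
  rw [show -(Complex.I * (l : ℂ) * (x : ℂ)) = ((-(l * x) : ℝ) : ℂ) * Complex.I by push_cast; ring]
  exact Complex.norm_exp_ofReal_mul_I _

theorem norm_fourier_stableCharFun {α : ℝ} (hα : 0 < α) (η b x l : ℝ) :
    ‖Complex.exp (-(Complex.I * (l : ℂ) * (x : ℂ))) * stableCharFun α η b l‖ =
      Real.exp (-(b * Real.cos (Real.pi * η / 2)) * |l| ^ α) := by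
  rw [norm_mul, norm_exp_neg_I_mul, one_mul, norm_stableCharFun hα]

theorem aestronglyMeasurable_fourier_stableCharFun (α η b x : ℝ) :
    AEStronglyMeasurable fun l : ℝ =>
      Complex.exp (-(Complex.I * (l : ℂ) * (x : ℂ))) * stableCharFun α η b l :=
  (Measurable.mul (by fun_prop) (measurable_stableCharFun α η b)).aestronglyMeasurable

theorem continuous_stableDensity {α η b : ℝ} (hα : 0 < α) (hb : 0 < b)
    (hη : 0 < Real.cos (Real.pi * η / 2)) : Continuous (stableDensity α η b) := by
  unfold stableDensity
  refine Complex.continuous_re.comp (continuous_const.mul ?_)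
  refine continuous_of_dominated (aestronglyMeasurable_fourier_stableCharFun α η b)
    (fun x => Eventually.of_forall fun l => (norm_fourier_stableCharFun hα η b x l).le)
    (integrable_exp_neg_mul_abs_rpow hα (mul_pos hb hη)) (Eventually.of_forall fun l => ?_)
  fun_prop

theorem stableDensity_eq_integral_Ioi {α η b : ℝ} (hα : 0 < α) (hb : 0 < b)
    (hη : 0 < Real.cos (Real.pi * η / 2)) (x : ℝ) :
    stableDensity α η b x = 1 / Real.pi * (∫ l in Set.Ioi (0 : ℝ),
      Complex.exp (-(Complex.I * (l : ℂ) * (x : ℂ)) - ((b * l ^ α : ℝ) : ℂ) *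
        Complex.exp (-(Complex.I * ((Real.pi * η / 2 : ℝ) : ℂ))))).re := by
  set f : ℝ → ℂ := fun l => Complex.exp (-(Complex.I * (l : ℂ) * (x : ℂ))) * stableCharFun α η b l
    with hf
  have hint : Integrable f :=
    (integrable_exp_neg_mul_abs_rpow hα (mul_pos hb hη)).mono'
      (aestronglyMeasurable_fourier_stableCharFun α η b x)
      (Eventually.of_forall fun l => (norm_fourier_stableCharFun hα η b x l).le)
  have hconj : ∀ l, f (-l) = (starRingEnd ℂ) (f l) := by
    intro l
    simp only [hf, stableCharFun, map_mul, ← Complex.exp_conj, map_neg, Complex.conj_ofReal,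
      Complex.conj_I, abs_neg, Complex.ofReal_neg, neg_div]
    congr 2 <;> ring_nf
  -- The two half-lines contribute conjugate values, so the sum is twice the real part of one of them.
  have hneg : ∫ l in Set.Iic (0 : ℝ), f l = (starRingEnd ℂ) (∫ l in Set.Ioi (0 : ℝ), f l) := by
    have h := integral_comp_neg_Ioi (0 : ℝ) f
    rw [neg_zero] at h
    rw [← h, ← integral_conj]
    simp_rw [hconj]
  have hsum := integral_add_compl (s := Set.Ioi (0 : ℝ)) measurableSet_Ioi hint
  rw [Set.compl_Ioi, hneg] at hsum
  have hcongr : ∫ l in Set.Ioi (0 : ℝ), f l = ∫ l in Set.Ioi (0 : ℝ),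
      Complex.exp (-(Complex.I * (l : ℂ) * (x : ℂ)) - ((b * l ^ α : ℝ) : ℂ) *
        Complex.exp (-(Complex.I * ((Real.pi * η / 2 : ℝ) : ℂ)))) := by
    refine setIntegral_congr_fun measurableSet_Ioi fun l hl => ?_
    have hl' : 0 < l := hl
    simp only [hf, stableCharFun, abs_of_pos hl', div_self hl'.ne', Complex.ofReal_one, mul_one]
    rw [← Complex.exp_add, neg_mul, sub_eq_add_neg]
  rw [stableDensity, Complex.re_ofReal_mul, ← hcongr]
  change _ * (∫ l, f l).re = _
  rw [← hsum, Complex.add_re, Complex.conj_re]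
  field_simp
  ring

/-! ### Zolotarev duality -/

/-- The substitution `z = iλx` turns the density of the spectrally negative law into an integral
along the imaginary half-axis. -/
theorem stableDensity_two_sub_eq {α c x : ℝ} (hα : 1 < α) (hα2 : α ≤ 2) (hc : 0 < c)
    (hx : 0 < x) :
    stableDensity α (2 - α) c x = 1 / Real.pi *
      ((∫ u : ℝ, rayIntegrand α (c * x ^ (-α)) (u + (Real.pi / 2 : ℝ) * Complex.I)).im / x) := by
  have hπ := Real.pi_pos
  have hcos : 0 < Real.cos (Real.pi * (2 - α) / 2) :=
    Real.cos_pos_of_mem_Ioo ⟨by nlinarith, by nlinarith⟩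
  rw [stableDensity_eq_integral_Ioi (by linarith) hc hcos,
    setIntegral_Ioi_eq_integral_exp one_pos (-Real.log x)]
  have hpt : ∀ u : ℝ, (1 * Real.exp (1 * u + -Real.log x)) •
      Complex.exp (-(Complex.I * (Real.exp (1 * u + -Real.log x) : ℂ) * (x : ℂ)) -
        ((c * Real.exp (1 * u + -Real.log x) ^ α : ℝ) : ℂ) *
        Complex.exp (-(Complex.I * ((Real.pi * (2 - α) / 2 : ℝ) : ℂ)))) =
      (-Complex.I / x) *
        rayIntegrand α (c * x ^ (-α)) (u + (Real.pi / 2 : ℝ) * Complex.I) := by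
    intro u
    have hxC : (x : ℂ) ≠ 0 := by exact_mod_cast hx.ne'
    have hexp : Real.exp (1 * u + -Real.log x) = Real.exp u / x := by
      rw [one_mul, Real.exp_add, Real.exp_neg, Real.exp_log hx, div_eq_mul_inv]
    have hpow : (Real.exp u / x) ^ α = x ^ (-α) * Real.exp (α * u) := by
      rw [Real.div_rpow (Real.exp_pos u).le hx.le, ← Real.exp_mul, Real.rpow_neg hx.le, mul_comm u α]
      field_simp
    have hI : Complex.exp ((Real.pi / 2 : ℝ) * Complex.I) = Complex.I := by
      push_cast
      exact Complex.exp_pi_div_two_mul_I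
    have hw : Complex.exp ((u : ℂ) + (Real.pi / 2 : ℝ) * Complex.I) = Real.exp u * Complex.I := by
      rw [Complex.exp_add, hI, Complex.ofReal_exp]
    have hang : Complex.exp (-(Complex.I * ((Real.pi * (2 - α) / 2 : ℝ) : ℂ))) =
        -Complex.exp (α * (Real.pi / 2 : ℝ) * Complex.I) := by
      have : -(Complex.I * ((Real.pi * (2 - α) / 2 : ℝ) : ℂ)) =
          α * (Real.pi / 2 : ℝ) * Complex.I - Real.pi * Complex.I := by push_cast; ring
      rw [this, Complex.exp_sub, Complex.exp_pi_mul_I, div_neg, div_one]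
    have hαw : Complex.exp (α * ((u : ℂ) + (Real.pi / 2 : ℝ) * Complex.I)) =
        Real.exp (α * u) * Complex.exp (α * (Real.pi / 2 : ℝ) * Complex.I) := by
      rw [mul_add, Complex.exp_add, ← mul_assoc]
      push_cast
      rfl
    have hray : rayIntegrand α (c * x ^ (-α)) (u + (Real.pi / 2 : ℝ) * Complex.I) =
        Real.exp u * Complex.I * Complex.exp (-(Real.exp u * Complex.I)) *
          Complex.exp (((c * x ^ (-α) : ℝ) : ℂ) *
            (Real.exp (α * u) * Complex.exp (α * (Real.pi / 2 : ℝ) * Complex.I))) := by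
      rw [rayIntegrand, Complex.exp_add, sub_eq_add_neg, Complex.exp_add, hαw, hw]
    have h1 : -(Complex.I * ((Real.exp u / x : ℝ) : ℂ) * (x : ℂ)) = -(Real.exp u * Complex.I) := by
      push_cast
      field_simp
    have h2 : -(((c * (x ^ (-α) * Real.exp (α * u)) : ℝ) : ℂ) *
        -Complex.exp (α * (Real.pi / 2 : ℝ) * Complex.I)) = ((c * x ^ (-α) : ℝ) : ℂ) *
          (Real.exp (α * u) * Complex.exp (α * (Real.pi / 2 : ℝ) * Complex.I)) := by
      push_cast
      ring
    rw [hexp, hpow, hang, hray, Complex.real_smul, sub_eq_add_neg, Complex.exp_add, h1, h2, one_mul,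
      Complex.ofReal_div]
    linear_combination (Real.exp u / x * Complex.exp (-(Real.exp u * Complex.I)) *
      Complex.exp (((c * x ^ (-α) : ℝ) : ℂ) * (Real.exp (α * u) *
        Complex.exp (α * (Real.pi / 2 : ℝ) * Complex.I)))) * Complex.I_mul_I
  simp_rw [hpt]
  rw [integral_const_mul]
  congr 1
  rw [div_mul_eq_mul_div, Complex.div_ofReal_re]
  simp

/-- Integration by parts followed by the substitution `z = b (-iλ) ^ γ` turns (the conjugate of) the
half-line integral for the one-sided law into an integral along the ray of angle `πγ/2`; the
boundary term is purely imaginary and does not contribute to the density. -/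
theorem stableDensity_self_eq {γ b y : ℝ} (hγ : 1 / 2 ≤ γ) (hγ' : γ < 1) (hb : 0 < b)
    (hy : 0 < y) :
    stableDensity γ γ b y = 1 / Real.pi *
      ((∫ u : ℝ, rayIntegrand (1 / γ) (y * b ^ (-(1 / γ)))
        (u + (Real.pi / (2 * (1 / γ)) : ℝ) * Complex.I)).im / y) := by
  have hπ := Real.pi_pos
  have hγ0 : 0 < γ := by linarith
  have hα : 1 < 1 / γ := by rw [lt_div_iff₀ hγ0]; linarith
  have hα2 : 1 / γ ≤ 2 := by rw [div_le_iff₀ hγ0]; linarith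
  have hα0 : 0 < 1 / γ := by linarith
  have hθ : Real.pi / (2 * (1 / γ)) = Real.pi * γ / 2 := by field_simp
  have hmem : Real.pi / (2 * (1 / γ)) ∈ Set.Icc (Real.pi / (2 * (1 / γ))) (Real.pi / 2) := by
    refine ⟨le_rfl, ?_⟩
    rw [hθ]; nlinarith
  have hcos : 0 < Real.cos (Real.pi * γ / 2) :=
    Real.cos_pos_of_mem_Ioo ⟨by nlinarith, by nlinarith⟩
  have hk : 0 < y * b ^ (-(1 / γ)) := by positivity
  have hray := integrable_rayIntegrand hα hα2 hk hmem
  rw [hθ] at hray ⊢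
  set θ := Real.pi * γ / 2 with hθdef
  -- In the coordinate `λ = (exp u / b) ^ (1/γ)` one has `b λ ^ γ = exp u`, and the integration by
  -- parts reads `∫ H' = H(∞) - H(-∞) = -1`, where `H = exp (iλy - b λ ^ γ exp (iθ))`.
  set q := -(1 / γ * Real.log b) with hq
  set lam : ℝ → ℝ := fun u => Real.exp (1 / γ * u + q) with hlam
  have hlam' : ∀ u, HasDerivAt lam (1 / γ * lam u) u := hasDerivAt_exp_affine (1 / γ) q
  have hlam_mul : ∀ u, lam u = b ^ (-(1 / γ)) * Real.exp (1 / γ * u) := by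
    intro u
    rw [hlam, Real.rpow_def_of_pos hb, ← Real.exp_add, hq]
    ring_nf
  have hlam_pow : ∀ u, b * lam u ^ γ = Real.exp u := by
    intro u
    have : (1 / γ * u + q) * γ = u - Real.log b := by rw [hq]; field_simp; ring
    rw [hlam]
    dsimp only
    rw [← Real.exp_mul, this, Real.exp_sub, Real.exp_log hb]
    field_simp
  let H : ℝ → ℂ := fun u =>
    Complex.exp (Complex.I * lam u * y - Complex.exp ((u : ℂ) + θ * Complex.I))
  have hnorm : ∀ u, ‖H u‖ = Real.exp (-(Real.cos θ * Real.exp u)) := by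
    intro u
    rw [Complex.norm_exp]
    congr 1
    simp [Complex.exp_re]
    ring
  have hHcont : Continuous H := by
    have hc : Continuous lam := by simp only [hlam]; fun_prop
    have hc' : Continuous fun u => (lam u : ℂ) := Complex.continuous_ofReal.comp hc
    fun_prop
  have hHderiv : ∀ u, HasDerivAt H ((Complex.I * y) * (((1 / γ * lam u : ℝ) : ℂ) * H u) -
      rayIntegrand (1 / γ) (y * b ^ (-(1 / γ))) (u + (θ : ℝ) * Complex.I)) u := by
    intro u
    have h1 : HasDerivAt (fun u : ℝ => Complex.I * (lam u : ℂ) * y)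
        (Complex.I * ((1 / γ * lam u : ℝ) : ℂ) * y) u :=
      (((hlam' u).ofReal_comp).const_mul Complex.I).mul_const (y : ℂ)
    have h2 : HasDerivAt (fun u : ℝ => Complex.exp ((u : ℂ) + θ * Complex.I))
        (Complex.exp ((u : ℂ) + θ * Complex.I)) u := by
      simpa using ((Complex.ofRealCLM.hasDerivAt (x := u)).add_const (θ * Complex.I)).cexp
    refine ((h1.sub h2).cexp).congr_deriv ?_
    have hang : ((y * b ^ (-(1 / γ)) : ℝ) : ℂ) * Complex.exp (((1 / γ : ℝ) : ℂ) *
        (u + (θ : ℝ) * Complex.I)) = Complex.I * lam u * y := by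
      have : ((1 / γ : ℝ) : ℂ) * (u + (θ : ℝ) * Complex.I) =
          ((1 / γ * u : ℝ) : ℂ) + Real.pi / 2 * Complex.I := by
        have : (γ : ℂ) ≠ 0 := by exact_mod_cast hγ0.ne'
        rw [hθdef]
        push_cast
        field_simp
      rw [this, Complex.exp_add, Complex.exp_pi_div_two_mul_I, hlam_mul]
      push_cast
      ring
    have hr : rayIntegrand (1 / γ) (y * b ^ (-(1 / γ))) (u + (θ : ℝ) * Complex.I) =
        Complex.exp ((u : ℂ) + θ * Complex.I) * H u := by
      rw [rayIntegrand, hang, ← Complex.exp_add]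
      congr 1
      ring
    rw [hr]
    change H u * _ = _
    ring
  have hint1 : Integrable fun u => ((1 / γ * lam u : ℝ) : ℂ) * H u := by
    refine ((integrable_exp_mul_exp_neg_exp hα0 hcos).const_mul
      (1 / γ * b ^ (-(1 / γ)))).mono' ?_ (Eventually.of_forall fun u => ?_)
    · have hc : Continuous lam := by simp only [hlam]; fun_prop
      exact ((Complex.continuous_ofReal.comp (continuous_const.mul hc)).mul
        hHcont).aestronglyMeasurable
    · have hl : 0 < lam u := Real.exp_pos _
      rw [norm_mul, hnorm, Complex.norm_real, Real.norm_of_nonneg (by positivity), hlam_mul]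
      apply le_of_eq
      ring
  have hbot : Tendsto H atBot (𝓝 1) := by
    have hl : Tendsto lam atBot (𝓝 0) :=
      Real.tendsto_exp_atBot.comp (tendsto_atBot_add_const_right _ _
        (tendsto_id.const_mul_atBot hα0))
    have h1 : Tendsto (fun u : ℝ => Complex.I * (lam u : ℂ) * y) atBot (𝓝 (Complex.I * 0 * y)) := by
      have := (Complex.continuous_ofReal.tendsto 0).comp hl
      rw [Complex.ofReal_zero] at this
      exact (this.const_mul _).mul_const _
    have h2 : Tendsto (fun u : ℝ => Complex.exp ((u : ℂ) + θ * Complex.I)) atBot (𝓝 0) := by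
      rw [tendsto_zero_iff_norm_tendsto_zero]
      refine Real.tendsto_exp_atBot.congr fun u => ?_
      rw [Complex.norm_exp]
      simp
    have h3 := (Complex.continuous_exp.tendsto _).comp (h1.sub h2)
    simp only [mul_zero, zero_mul, sub_zero, Complex.exp_zero] at h3
    exact h3
  have htop : Tendsto H atTop (𝓝 0) := by
    rw [tendsto_zero_iff_norm_tendsto_zero]
    simp_rw [hnorm]
    exact Real.tendsto_exp_neg_atTop_nhds_zero.comp (Real.tendsto_exp_atTop.const_mul_atTop hcos)
  have hparts := integral_of_hasDerivAt_of_tendsto hHderiv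
    ((hint1.const_mul (Complex.I * y)).sub hray) hbot htop
  rw [integral_sub (hint1.const_mul _) hray, integral_const_mul] at hparts
  rw [stableDensity_eq_integral_Ioi hγ0 hb hcos, ← Complex.conj_re, ← integral_conj,
    setIntegral_Ioi_eq_integral_exp hα0 q]
  have hpt : ∀ u : ℝ, (1 / γ * Real.exp (1 / γ * u + q)) • (starRingEnd ℂ)
      (Complex.exp (-(Complex.I * (Real.exp (1 / γ * u + q) : ℂ) * (y : ℂ)) -
        ((b * Real.exp (1 / γ * u + q) ^ γ : ℝ) : ℂ) *
        Complex.exp (-(Complex.I * (θ : ℂ))))) = ((1 / γ * lam u : ℝ) : ℂ) * H u := by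
    intro u
    change (1 / γ * lam u) • (starRingEnd ℂ)
      (Complex.exp (-(Complex.I * (lam u : ℂ) * (y : ℂ)) - ((b * lam u ^ γ : ℝ) : ℂ) *
        Complex.exp (-(Complex.I * (θ : ℂ))))) = _
    rw [hlam_pow, Complex.real_smul, ← Complex.exp_conj]
    simp only [map_sub, map_neg, map_mul, Complex.conj_I, Complex.conj_ofReal, ← Complex.exp_conj]
    simp only [H]
    rw [Complex.exp_add (u : ℂ), Complex.ofReal_exp]
    congr 3
    · ring
    · rw [neg_mul, neg_neg, mul_comm Complex.I, Complex.ofReal_exp]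
  simp_rw [← hθdef, hpt]
  congr 1
  set K := ∫ u, ((1 / γ * lam u : ℝ) : ℂ) * H u
  set R := ∫ u : ℝ, rayIntegrand (1 / γ) (y * b ^ (-(1 / γ))) (u + (θ : ℝ) * Complex.I)
  have him := congrArg Complex.im hparts
  simp at him
  rw [eq_div_iff hy.ne']
  linarith

theorem stableDensity_two_sub_eq_mul_inverseStableDensity {γ α b : ℝ} (hγ : 1 / 2 ≤ γ)
    (hγ' : γ < 1) (hα : α = 1 / γ) (hb : 0 < b) {t x : ℝ} (ht : 0 < t) (hx : 0 < x) :
    stableDensity α (2 - α) (b ^ (-α) * t) x = γ * inverseStableDensity γ b t x := by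
  subst hα
  have hγ0 : 0 < γ := by linarith
  have hα : 1 < 1 / γ := by rw [lt_div_iff₀ hγ0]; linarith
  have hα2 : 1 / γ ≤ 2 := by rw [div_le_iff₀ hγ0]; linarith
  have hk : t * x ^ (-(1 / γ)) * b ^ (-(1 / γ)) = b ^ (-(1 / γ)) * t * x ^ (-(1 / γ)) := by ring
  rw [inverseStableDensity, Set.indicator_of_mem (Set.mem_Ioi.2 hx), neg_div,
    stableDensity_two_sub_eq hα hα2 (by positivity) hx,
    stableDensity_self_eq hγ hγ' hb (by positivity), hk,
    integral_rayIntegrand_eq hα hα2 (by positivity), sub_eq_add_neg,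
    Real.rpow_add hx, Real.rpow_neg_one]
  have hxp : x ^ (-(1 / γ)) ≠ 0 := (Real.rpow_pos_of_pos hx _).ne'
  field_simp

/-! ### The measure with density `h(·, t)` -/

theorem stableDensity_mul {α : ℝ} (hα : 0 < α) (η b : ℝ) {s : ℝ} (hs : 0 < s) (u : ℝ) :
    stableDensity α η (b * s) u =
      s ^ (-(1 / α)) * stableDensity α η b (u * s ^ (-(1 / α))) := by
  set a := s ^ (1 / α) with ha
  have ha0 : 0 < a := Real.rpow_pos_of_pos hs _
  have haα : a ^ α = s := by
    rw [ha, ← Real.rpow_mul hs.le, one_div, inv_mul_cancel₀ hα.ne', Real.rpow_one]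
  rw [Real.rpow_neg hs.le, ← ha]
  have h := Measure.integral_comp_mul_left (fun l : ℝ =>
    Complex.exp (-(Complex.I * (l : ℂ) * ((u * a⁻¹ : ℝ) : ℂ))) * stableCharFun α η b l) a
  have hpt : ∀ l : ℝ, Complex.exp (-(Complex.I * ((a * l : ℝ) : ℂ) * ((u * a⁻¹ : ℝ) : ℂ))) *
      stableCharFun α η b (a * l) =
      Complex.exp (-(Complex.I * (l : ℂ) * (u : ℂ))) * stableCharFun α η (b * s) l := by
    intro l
    have haC : (a : ℂ) ≠ 0 := by exact_mod_cast ha0.ne'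
    have h1 : Complex.I * ((a * l : ℝ) : ℂ) * ((u * a⁻¹ : ℝ) : ℂ) = Complex.I * l * u := by
      push_cast
      field_simp
    rw [h1, stableCharFun, stableCharFun, abs_mul, abs_of_pos ha0,
      Real.mul_rpow ha0.le (abs_nonneg l), haα, mul_div_mul_left _ _ ha0.ne', mul_assoc b]
  simp_rw [hpt] at h
  rw [stableDensity, stableDensity, h, abs_of_pos (inv_pos.2 ha0), Complex.real_smul,
    mul_left_comm, Complex.re_ofReal_mul]

theorem cos_pi_mul_div_two_pos {γ : ℝ} (hγ : 0 < γ) (hγ' : γ < 1) :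
    0 < Real.cos (Real.pi * γ / 2) := by
  have hπ := Real.pi_pos
  exact Real.cos_pos_of_mem_Ioo ⟨by nlinarith, by nlinarith⟩

theorem HasDensity.nonneg_of_continuous {Ω : Type*} [MeasurableSpace Ω] {X : Ω → ℝ} {f : ℝ → ℝ}
    {P : Measure Ω} (h : HasDensity X f P) (hf : Continuous f) (x : ℝ) : 0 ≤ f x := by
  have h0 : volume {x | f x < 0} = 0 := by
    have := ae_iff.1 h.nonneg
    simpa only [not_le] using this
  have hempty := (isOpen_lt hf continuous_const).measure_zero_iff_eq_empty.1 h0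
  by_contra! hx
  exact (hempty ▸ (show x ∈ {x | f x < 0} from hx) : x ∈ (∅ : Set ℝ))

theorem HasDensity.measure_preimage {Ω : Type*} [MeasurableSpace Ω] {X : Ω → ℝ} {f : ℝ → ℝ}
    {P : Measure Ω} (h : HasDensity X f P) {s : Set ℝ} (hs : MeasurableSet s) :
    P (X ⁻¹' s) = ∫⁻ x in s, ENNReal.ofReal (f x) := by
  rw [← Measure.map_apply_of_aemeasurable h.aemeasurable hs, h.map_eq, withDensity_apply _ hs]

/-- The measure with density `h(·, t)`, which is the law of the hitting time. -/
noncomputable def inverseStableMeasure (γ b t : ℝ) : Measure ℝ :=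
  volume.withDensity fun x => ENNReal.ofReal (inverseStableDensity γ b t x)

theorem inverseStableMeasure_apply (γ b t : ℝ) {s : Set ℝ} (hs : MeasurableSet s) :
    inverseStableMeasure γ b t s =
      ∫⁻ x in Set.Ioi 0 ∩ s, ENNReal.ofReal (inverseStableDensity γ b t x) := by
  rw [inverseStableMeasure, withDensity_apply _ hs, ← setLIntegral_indicator measurableSet_Ioi]
  refine lintegral_congr fun x => ?_
  by_cases hx : x ∈ Set.Ioi (0 : ℝ)
  · rw [Set.indicator_of_mem hx]
  · rw [Set.indicator_of_notMem hx, inverseStableDensity, Set.indicator_of_notMem hx,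
      ENNReal.ofReal_zero]

theorem inverseStableMeasure_Iic_of_nonpos (γ b t : ℝ) {x : ℝ} (hx : x ≤ 0) :
    inverseStableMeasure γ b t (Set.Iic x) = 0 := by
  rw [inverseStableMeasure_apply _ _ _ measurableSet_Iic, Set.Ioi_inter_Iic, Set.Ioc_eq_empty
    (not_lt.2 hx)]
  simp

/-- The change of variables `u = c r ^ (-1/γ)`, which carries `h(r, t) dr` to the stable law rescaled
by `t / c`. -/
theorem lintegral_inverseStableDensity {γ b t c : ℝ} (hγ : 0 < γ) (ht : 0 < t) (hc : 0 < c)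
    {s : Set ℝ} (hs : MeasurableSet s) (hs0 : s ⊆ Set.Ioi 0) :
    ∫⁻ u in (fun r : ℝ => c * r ^ (-(1 / γ))) '' s,
        ENNReal.ofReal (t / c * stableDensity γ γ b (u * (t / c))) =
      ∫⁻ r in s, ENNReal.ofReal (inverseStableDensity γ b t r) := by
  have hderiv : ∀ r ∈ s, HasDerivWithinAt (fun r : ℝ => c * r ^ (-(1 / γ)))
      (c * (-(1 / γ) * r ^ (-(1 / γ) - 1))) s r := fun r hr =>
    ((Real.hasDerivAt_rpow_const (Or.inl (ne_of_gt (hs0 hr)))).const_mul c).hasDerivWithinAt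
  have hinj : Set.InjOn (fun r : ℝ => c * r ^ (-(1 / γ))) s := by
    intro r hr r' hr' h
    exact Real.rpow_left_injOn (by simpa using hγ.ne') (Set.mem_Ioi.1 (hs0 hr)).le
      (Set.mem_Ioi.1 (hs0 hr')).le (mul_left_cancel₀ hc.ne' h)
  rw [lintegral_image_eq_lintegral_abs_deriv_mul hs hderiv hinj]
  refine setLIntegral_congr_fun hs fun r hr => ?_
  have hr0 : 0 < r := hs0 hr
  have habs : |c * (-(1 / γ) * r ^ (-(1 / γ) - 1))| = c / γ * r ^ (-(1 / γ) - 1) := by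
    rw [show c * (-(1 / γ) * r ^ (-(1 / γ) - 1)) = -(c / γ * r ^ (-(1 / γ) - 1)) by ring, abs_neg,
      abs_of_pos (by positivity)]
  rw [← ENNReal.ofReal_mul (abs_nonneg _), habs, inverseStableDensity,
    Set.indicator_of_mem (Set.mem_Ioi.2 hr0)]
  congr 1
  rw [show c * r ^ (-(1 / γ)) * (t / c) = t * r ^ (-1 / γ) by rw [neg_div]; field_simp,
    show -1 - 1 / γ = -(1 / γ) - 1 by ring]
  field_simp

theorem image_mul_rpow_neg_Ioi_zero {p c : ℝ} (hp : 0 < p) (hc : 0 < c) :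
    (fun r : ℝ => c * r ^ (-p)) '' Set.Ioi 0 = Set.Ioi 0 := by
  ext u
  constructor
  · rintro ⟨r, hr, rfl⟩
    exact mul_pos hc (Real.rpow_pos_of_pos hr _)
  · intro hu
    have hu0 : 0 < u := hu
    refine ⟨(u / c) ^ (-p)⁻¹, Real.rpow_pos_of_pos (div_pos hu0 hc) _, ?_⟩
    dsimp only
    rw [Real.rpow_inv_rpow (div_pos hu0 hc).le (neg_ne_zero.2 hp.ne')]
    field_simp

theorem image_mul_rpow_neg_Ioo {p c x : ℝ} (hp : 0 < p) (hc : 0 < c) (hx : 0 < x) :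
    (fun r : ℝ => c * r ^ (-p)) '' Set.Ioo 0 x = Set.Ioi (c * x ^ (-p)) := by
  have hanti : ∀ {r s : ℝ}, 0 < r → 0 < s → (c * s ^ (-p) < c * r ^ (-p) ↔ r < s) := by
    intro r s hr hs
    rw [mul_lt_mul_iff_right₀ hc, Real.rpow_lt_rpow_iff_of_neg hs hr (neg_lt_zero.2 hp)]
  ext u
  constructor
  · rintro ⟨r, hr, rfl⟩
    exact (hanti hr.1 hx).2 hr.2
  · intro hu
    have hu0 : u ∈ Set.Ioi (0 : ℝ) := lt_trans (mul_pos hc (Real.rpow_pos_of_pos hx _)) hu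
    rw [← image_mul_rpow_neg_Ioi_zero hp hc] at hu0
    obtain ⟨r, hr, rfl⟩ := hu0
    exact ⟨r, ⟨hr, (hanti hr hx).1 hu⟩, rfl⟩

/-! ### The law of the hitting time -/

section HittingTime

variable {Ω : Type*} [MeasurableSpace Ω] {P : Measure Ω} {D : ℝ≥0 → Ω → ℝ} {γ b : ℝ}

/-- By self-similarity of the subordinator, its law at time `x` is tied to the law of the hitting
time of level `t`. -/
theorem measure_lt_eq_inverseStableMeasure_Iic (hγ : 0 < γ)
    (hD : ∀ t : ℝ≥0, 0 < t → HasDensity (D t) (stableDensity γ γ (b * t)) P)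
    {t : ℝ} (ht : 0 < t) {x : ℝ≥0} (hx : 0 < x) :
    P {ω | t < D x ω} = inverseStableMeasure γ b t (Set.Iic x) := by
  have hx' : (0 : ℝ) < x := hx
  have hp : 0 < 1 / γ := by positivity
  -- This `c` is chosen so that `r ↦ c r ^ (-1/γ)` maps `(0, x)` onto `(t, ∞)`, and so that the law
  -- of `D x` is that of `D 1` rescaled by `t / c`.
  set c := t * (x : ℝ) ^ (1 / γ) with hc
  have hc0 : 0 < c := by positivity
  have htc : t / c = (x : ℝ) ^ (-(1 / γ)) := by
    rw [hc, Real.rpow_neg hx'.le]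
    field_simp
  have hcx : c * (x : ℝ) ^ (-(1 / γ)) = t := by
    rw [← htc]
    field_simp
  rw [inverseStableMeasure_apply _ _ _ measurableSet_Iic, Set.Ioi_inter_Iic,
    ← setLIntegral_congr Ioo_ae_eq_Ioc,
    ← lintegral_inverseStableDensity hγ ht hc0 measurableSet_Ioo Set.Ioo_subset_Ioi_self,
    image_mul_rpow_neg_Ioo hp hc0 hx', hcx, htc]
  simp_rw [← stableDensity_mul hγ γ b hx']
  exact (hD x hx).measure_preimage measurableSet_Ioi

theorem IsSubordinator.measure_pos_eq_one [IsProbabilityMeasure P] (hD : IsSubordinator D P)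
    {t : ℝ≥0} {f : ℝ → ℝ} (hf : HasDensity (D t) f P) : P {ω | 0 < D t ω} = 1 := by
  have h0 : P (D t ⁻¹' {0}) = 0 := by
    rw [hf.measure_preimage (measurableSet_singleton 0)]
    simp
  have hpos : ∀ᵐ ω ∂P, ω ∈ {ω | 0 < D t ω} := by
    filter_upwards [hD.monotone, hD.zero, measure_eq_zero_iff_ae_notMem.1 h0] with ω hm hz hne
    have hle : D 0 ω ≤ D t ω := hm bot_le
    rw [hz] at hle
    exact lt_of_le_of_ne hle fun h => hne h.symm
  exact (measure_congr (eventuallyEq_univ.2 hpos)).trans measure_univ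

theorem isProbabilityMeasure_inverseStableMeasure [IsProbabilityMeasure P]
    (hγ : 0 < γ) (hD : IsSubordinator D P)
    (hD' : ∀ t : ℝ≥0, 0 < t → HasDensity (D t) (stableDensity γ γ (b * t)) P)
    {t : ℝ} (ht : 0 < t) : IsProbabilityMeasure (inverseStableMeasure γ b t) := by
  have h1 := hD' 1 one_pos
  have hone : (fun u => ENNReal.ofReal (t / t * stableDensity γ γ b (u * (t / t)))) =
      fun u => ENNReal.ofReal (stableDensity γ γ (b * (1 : ℝ≥0)) u) := by
    simp [div_self ht.ne']
  constructor
  rw [inverseStableMeasure_apply _ _ _ MeasurableSet.univ, Set.inter_univ,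
    ← lintegral_inverseStableDensity hγ ht ht measurableSet_Ioi subset_rfl,
    image_mul_rpow_neg_Ioi_zero (by positivity) ht, hone,
    ← h1.measure_preimage measurableSet_Ioi]
  exact hD.measure_pos_eq_one h1

theorem lt_of_hittingTimeProcess_lt {Ω : Type*} {D : ℝ≥0 → Ω → ℝ} {t x : ℝ≥0} {ω : Ω} (hm : Monotone fun t => D t ω)
    (h : hittingTimeProcess D t ω < x) : (t : ℝ) < D x ω := by
  simp only [hittingTimeProcess, iInf_lt_iff] at h
  obtain ⟨y, ⟨_, hy⟩, hyx⟩ := h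
  exact hy.trans_le (hm (ENNReal.coe_lt_coe.1 hyx).le)

theorem hittingTimeProcess_le {Ω : Type*} {D : ℝ≥0 → Ω → ℝ} {t x : ℝ≥0} {ω : Ω} (hx : 0 < x) (h : (t : ℝ) < D x ω) :
    hittingTimeProcess D t ω ≤ x :=
  iInf₂_le x ⟨hx, h⟩

/-- For nondecreasing paths the infimum defining the hitting time may be restricted to a countable
dense set of times, which makes it a random variable up to a null set. -/
theorem aemeasurable_hittingTimeProcess (hD : IsSubordinator D P) (t : ℝ≥0) :
    AEMeasurable (hittingTimeProcess D t) P := by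
  classical
  obtain ⟨S, hS, hSd⟩ := TopologicalSpace.exists_countable_dense ℝ≥0
  refine ⟨fun ω => ⨅ x ∈ S, if 0 < x ∧ (t : ℝ) < D x ω then (x : ℝ≥0∞) else ∞, ?_, ?_⟩
  · refine Measurable.biInf S hS fun x _ => Measurable.ite ?_ measurable_const measurable_const
    exact (MeasurableSet.const _).inter (measurableSet_lt measurable_const (hD.measurable x))
  · filter_upwards [hD.monotone] with ω hm
    apply le_antisymm
    · refine le_iInf₂ fun x _ => ?_
      split_ifs with h
      · exact hittingTimeProcess_le h.1 h.2
      · exact le_top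
    · refine le_of_forall_gt fun z hz => ?_
      simp only [hittingTimeProcess, iInf_lt_iff] at hz
      obtain ⟨y, ⟨hy, hty⟩, hyz⟩ := hz
      obtain ⟨r, hyr, hrz⟩ := ENNReal.lt_iff_exists_nnreal_btwn.1 hyz
      obtain ⟨q, hqS, hyq, hqr⟩ := hSd.exists_between (ENNReal.coe_lt_coe.1 hyr)
      refine (iInf₂_le q hqS).trans_lt ?_
      rw [if_pos ⟨hy.trans hyq, hty.trans_le (hm hyq.le)⟩]
      exact (ENNReal.coe_lt_coe.2 hqr).trans hrz

theorem inverseStableDensity_nonneg (hγ : 0 < γ) (hγ' : γ < 1) (hb : 0 < b)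
    (hD' : ∀ t : ℝ≥0, 0 < t → HasDensity (D t) (stableDensity γ γ (b * t)) P)
    {t : ℝ} (ht : 0 < t) (x : ℝ) : 0 ≤ inverseStableDensity γ b t x := by
  have h1 := hD' 1 one_pos
  rw [NNReal.coe_one, mul_one] at h1
  have hg := h1.nonneg_of_continuous
    (continuous_stableDensity hγ hb (cos_pi_mul_div_two_pos hγ hγ'))
  refine Set.indicator_nonneg (fun x hx => ?_) x
  have hx0 : 0 < x := hx
  exact mul_nonneg (by positivity) (hg _)

variable [IsProbabilityMeasure P]

theorem ae_hittingTimeProcess_ne_top (hγ : 0 < γ) (hD : IsSubordinator D P)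
    (hD' : ∀ t : ℝ≥0, 0 < t → HasDensity (D t) (stableDensity γ γ (b * t)) P)
    {t : ℝ≥0} (ht : 0 < t) : ∀ᵐ ω ∂P, hittingTimeProcess D t ω ≠ ∞ := by
  have := isProbabilityMeasure_inverseStableMeasure hγ hD hD' (NNReal.coe_pos.2 ht)
  have hnull : NullMeasurableSet {ω | hittingTimeProcess D t ω ≠ ∞} P :=
    (aemeasurable_hittingTimeProcess hD t).nullMeasurableSet_preimage
      (measurableSet_singleton ∞).compl
  suffices h : P {ω | hittingTimeProcess D t ω ≠ ∞} = 1 from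
    (prob_compl_eq_zero_iff₀ hnull).2 h
  refine le_antisymm prob_le_one ?_
  have hlim := tendsto_measure_Iic_atTop (inverseStableMeasure γ b t)
  rw [measure_univ] at hlim
  refine le_of_tendsto hlim ?_
  filter_upwards [eventually_gt_atTop 0] with x hx
  lift x to ℝ≥0 using hx.le
  rw [← measure_lt_eq_inverseStableMeasure_Iic hγ hD' (NNReal.coe_pos.2 ht) (NNReal.coe_pos.1 hx)]
  exact measure_mono fun ω hω => ne_top_of_le_ne_top ENNReal.coe_ne_top
    (hittingTimeProcess_le hx hω)

theorem map_hittingTimeProcess (hγ : 0 < γ) (hD : IsSubordinator D P)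
    (hD' : ∀ t : ℝ≥0, 0 < t → HasDensity (D t) (stableDensity γ γ (b * t)) P)
    {t : ℝ≥0} (ht : 0 < t) :
    P.map (fun ω => (hittingTimeProcess D t ω).toReal) = inverseStableMeasure γ b t := by
  have hprob := isProbabilityMeasure_inverseStableMeasure hγ hD hD' (NNReal.coe_pos.2 ht)
  have hmeas : AEMeasurable (fun ω => (hittingTimeProcess D t ω).toReal) P :=
    (aemeasurable_hittingTimeProcess hD t).ennreal_toReal
  have hfin := ae_hittingTimeProcess_ne_top hγ hD hD' ht
  have := Measure.isProbabilityMeasure_map hmeas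
  refine Measure.ext_of_Iic _ _ fun x => ?_
  rw [Measure.map_apply_of_aemeasurable hmeas measurableSet_Iic]
  apply le_antisymm
  · rcases lt_or_ge x 0 with hx | hx
    · have : (fun ω => (hittingTimeProcess D t ω).toReal) ⁻¹' Set.Iic x = ∅ := by
        ext ω
        simp only [Set.mem_preimage, Set.mem_Iic, Set.mem_empty_iff_false, iff_false, not_le]
        exact hx.trans_le ENNReal.toReal_nonneg
      rw [this, measure_empty]
      exact bot_le
    -- Only `E_t < r` gives back `D r > t`, so the bound at `x` is the limit of those at `r > x`.
    · have hlim := tendsto_measure_biInter_gt (μ := inverseStableMeasure γ b t)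
        (s := fun r : ℝ => Set.Iic r) (a := x) (fun r _ => measurableSet_Iic.nullMeasurableSet)
        (fun i j _ hij => Set.Iic_subset_Iic.2 hij) ⟨x + 1, by simp, measure_ne_top _ _⟩
      have hset : ⋂ r, ⋂ (_ : r > x), Set.Iic r = Set.Iic x := by
        ext y
        simp only [Set.mem_iInter, Set.mem_Iic]
        exact ⟨fun h => le_of_forall_gt_imp_ge_of_dense h, fun h r hr => h.trans hr.le⟩
      rw [hset] at hlim
      refine ge_of_tendsto hlim ?_
      filter_upwards [self_mem_nhdsWithin] with r hr
      have hr0 : 0 < r := lt_of_le_of_lt hx hr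
      lift r to ℝ≥0 using hr0.le
      change _ ≤ inverseStableMeasure γ b t (Set.Iic (r : ℝ))
      rw [← measure_lt_eq_inverseStableMeasure_Iic hγ hD' (NNReal.coe_pos.2 ht) (NNReal.coe_pos.1 hr0)]
      refine measure_mono_ae ?_
      filter_upwards [hfin, hD.monotone] with ω hω hm hle
      refine lt_of_hittingTimeProcess_lt hm ?_
      rw [← ENNReal.toReal_lt_toReal hω ENNReal.coe_ne_top]
      exact lt_of_le_of_lt hle hr
  · rcases le_or_gt x 0 with hx | hx
    · rw [inverseStableMeasure_Iic_of_nonpos _ _ _ hx]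
      exact bot_le
    · lift x to ℝ≥0 using hx.le
      rw [← measure_lt_eq_inverseStableMeasure_Iic hγ hD' (NNReal.coe_pos.2 ht) (NNReal.coe_pos.1 hx)]
      exact measure_mono fun ω hω =>
        ENNReal.toReal_le_of_le_ofReal x.2 (by simpa using hittingTimeProcess_le hx hω)

end HittingTime

/-- The law of the spectrally negative process on the positive half-line is `γ` times the law of the
hitting time. -/
theorem measure_Ioi_inter_preimage {Ω : Type*} [MeasurableSpace Ω] {P : Measure Ω} {X : Ω → ℝ}
    {γ α b t : ℝ} (hγ : 1 / 2 ≤ γ) (hγ' : γ < 1) (hα : α = 1 / γ) (hb : 0 < b) (ht : 0 < t)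
    (hX : HasDensity X (stableDensity α (2 - α) (b ^ (-α) * t)) P) {s : Set ℝ}
    (hs : MeasurableSet s) :
    P ({ω | 0 < X ω} ∩ X ⁻¹' s) = ENNReal.ofReal γ * inverseStableMeasure γ b t s := by
  have hset : MeasurableSet (Set.Ioi 0 ∩ s) := measurableSet_Ioi.inter hs
  change P (X ⁻¹' (Set.Ioi 0 ∩ s)) = _
  rw [hX.measure_preimage hset, inverseStableMeasure_apply _ _ _ hs,
    ← lintegral_const_mul' _ _ ENNReal.ofReal_ne_top]
  refine setLIntegral_congr_fun hset fun x hx => ?_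
  rw [stableDensity_two_sub_eq_mul_inverseStableDensity hγ hγ' hα hb ht hx.1,
    ENNReal.ofReal_mul (by linarith)]

/-! ### Hitting times and the spectrally negative process -/

theorem theorem4p1
    {Ω Ω' : Type*} [MeasurableSpace Ω] [MeasurableSpace Ω']
    (P : Measure Ω) [IsProbabilityMeasure P] (P' : Measure Ω') [IsProbabilityMeasure P']
    (γ α b : ℝ) (hγ : 1 / 2 ≤ γ) (hγ' : γ < 1) (hα : α = 1 / γ) (hb : 0 < b)
    (D : ℝ≥0 → Ω → ℝ) (hD : IsSubordinator D P)
    (hD_density : ∀ t : ℝ≥0, 0 < t → HasDensity (D t) (stableDensity γ γ (b * t)) P)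
    (Y : ℝ≥0 → Ω' → ℝ) (hY : IsLevyProcess Y P')
    (hY_density : ∀ t : ℝ≥0, 0 < t →
      HasDensity (Y t) (stableDensity α (2 - α) (b ^ (-α) * t)) P') :
    -- the probability that `Y(t)` is positive
    (∀ t : ℝ≥0, 0 < t → P'.real {ω | 0 < Y t ω} = 1 / α) ∧
    -- `E_t` is almost surely finite and distributed as `Y(t)` given `Y(t) > 0`
    (∀ t : ℝ≥0, 0 < t →
      (∀ᵐ ω ∂P, hittingTimeProcess D t ω ≠ ∞) ∧
      IdentDistrib (fun ω => (hittingTimeProcess D t ω).toReal) (Y t)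
        P (P'[|{ω | 0 < Y t ω}])) ∧
    -- `E_t` has the density `h(·, t)`
    (∀ t : ℝ≥0, 0 < t →
      HasDensity (fun ω => (hittingTimeProcess D t ω).toReal) (inverseStableDensity γ b t) P) ∧
    -- the identity `P(x, t) = γ h(x, t)` between the two densities
    (∀ t x : ℝ, 0 < t → 0 < x →
      stableDensity α (2 - α) (b ^ (-α) * t) x = γ * inverseStableDensity γ b t x) := by

  have hγ0 : 0 < γ := by linarith
  have hY' : ∀ t : ℝ≥0, 0 < t → P' {ω | 0 < Y t ω} = ENNReal.ofReal γ := by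
    intro t ht
    have := isProbabilityMeasure_inverseStableMeasure hγ0 hD hD_density (NNReal.coe_pos.2 ht)
    have h := measure_Ioi_inter_preimage hγ hγ' hα hb (NNReal.coe_pos.2 ht) (hY_density t ht) MeasurableSet.univ
    rwa [Set.preimage_univ, Set.inter_univ, measure_univ, mul_one] at h
  have hmeas : ∀ t, AEMeasurable (fun ω => (hittingTimeProcess D t ω).toReal) P := fun t =>
    (aemeasurable_hittingTimeProcess hD t).ennreal_toReal
  refine ⟨fun t ht => ?_, fun t ht => ⟨ae_hittingTimeProcess_ne_top hγ0 hD hD_density ht,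
    hmeas t, (hY.measurable t).aemeasurable, ?_⟩, fun t ht => ⟨hmeas t, ?_, ?_⟩,
    fun t x ht hx => stableDensity_two_sub_eq_mul_inverseStableDensity hγ hγ' hα hb ht hx⟩
  · rw [measureReal_def, hY' t ht, ENNReal.toReal_ofReal hγ0.le, hα, one_div_one_div]
  · rw [map_hittingTimeProcess hγ0 hD hD_density ht]
    ext s hs
    rw [Measure.map_apply (hY.measurable t) hs,
      cond_apply (measurableSet_lt measurable_const (hY.measurable t)), hY' t ht,
      measure_Ioi_inter_preimage hγ hγ' hα hb (NNReal.coe_pos.2 ht) (hY_density t ht) hs, ← mul_assoc,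
      ENNReal.inv_mul_cancel (ENNReal.ofReal_pos.2 hγ0).ne' ENNReal.ofReal_ne_top, one_mul]
  · exact Eventually.of_forall (inverseStableDensity_nonneg hγ0 hγ' hb hD_density
      (NNReal.coe_pos.2 ht))
  · exact map_hittingTimeProcess hγ0 hD hD_density ht
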